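/- Let $k\ge 2$ and let $V$ be a $(k-1)$-dimensional linear subspace of $\mathbb R^k$. Let $\pi:\mathbb R^k\to\mathbb R^k/\mathbb Z^k$ be the canonical projection, and for $\mathcal S\subseteq\mathbb R^k/\mathbb Z^k$ and $x\in\mathbb R^k$ put $Y_{\mathcal S,x}=\{v\in V:\pi(v+x)\in\mathcal S\}$. **Special intervals.** For an irrational $\alpha\in(0,1)$ with continued fraction $[0;a_1,a_2,\dots]$ and convergent denominators $q_0,q_1,\dots$, every integer $n\ge 0$ has a unique Ostrowski expansion $n=\sum_{k\ge0}c_{k+1}q_k$ (a finite sum) with integer digits satisfying $0\le c_1<a_1$, $0\le c_{k+1}\le a_{k+1}$ for $k\ge1$, and $c_k=0$ whenever $c_{k+1}=a_{k+1}$ with $k\ge 1$. For $m\ge1$ let $A(m)$ be the set of $n\ge 0$ with $c_{k+1}=0$ for all $k<m$, and for $\gamma\in\mathbb R/\mathbb Z$ let $J(m,\gamma)=\gamma+\overline{\{n\alpha: n\in A(m)\}}\subseteq\mathbb R/\mathbb Z$; the intervals $J(m,\gamma)$ are the special intervals for $\alpha$. Let $e_j$ be a standard basis vector not in $V$, so that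 $V=\{y\in\mathbb R^k: y_j=\sum_{i\ne j}a_iy_i\}$ for unique real numbers $a_i$ $(i\neq j)$. A special interval for $V$ in the direction $e_j$ is a special interval for the fractional part $\alpha=\{a_i\}$ of some irrational $a_i$ $(i\neq j)$; its end points may be included or not. We say that $\mathcal S$ is a special interval for $V$ if $\mathcal S=\pi(\{p+te_j: t\in\mathbb R,\ t\bmod 1\in T\})$ for some such $j$, some $p\in\mathbb R^k$ and some special interval $T$ for $V$ in the direction $e_j$. Write $|\mathcal S|=|T|$ for its length. **Theorem.** There is a constant $K_V$, depending only on $V$, such that for every special interval $\mathcal S$ for $V$ (with any choice of $j$, $p$ and $T$) and every $x\in\mathbb R^k$ there are a lattice $L$ in $V$ (a discrete subgroup of $V$ that spans $V$) and a bijection $f:Y_{\mathcal S,x}\to L$ with $$\sup_{y\in Y_{\mathcal S,x}}|f(y)-y|\le K_V\,|\mathcal S|^{-1}.$$ -/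

import Mathlib

namespace CutProject

noncomputable section

/-! ### Continued fractions and Ostrowski expansions -/

/-- The complete quotients `ζ_k = [a_k; a_{k+1}, …]` of a real number:
`ζ_0 = α` and `ζ_{k+1} = 1 / {ζ_k}`. -/
def completeQuotient (α : ℝ) : ℕ → ℝ
  | 0 => α
  | k + 1 => (Int.fract (completeQuotient α k))⁻¹

/-- The partial quotients `a_k = ⌊ζ_k⌋`. For `k ≥ 1`, and for `k = 0` when `α ≥ 0`,
this natural number is the usual integer `a_k`. -/
def partialQuotient (α : ℝ) (k : ℕ) : ℕ := ⌊completeQuotient α k⌋₊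

/-- The denominators `q_k` of the principal convergents `p_k / q_k = [a_0; a_1, …, a_k]`. -/
def convergentDen (α : ℝ) : ℕ → ℕ
  | 0 => 1
  | 1 => partialQuotient α 1
  | k + 2 => partialQuotient α (k + 2) * convergentDen α (k + 1) + convergentDen α k

/-- `c` is the digit sequence of the Ostrowski expansion of `n` with respect to `α`, where
`c k` is the digit `c_{k+1}` of `n = ∑_{k ≥ 0} c_{k+1} q_k`. The conditions are
`0 ≤ c_1 < a_1`, `0 ≤ c_{k+1} ≤ a_{k+1}` for `k ≥ 1`, `c_k = 0` whenever `c_{k+1} = a_{k+1}`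
with `k ≥ 1`, and all but finitely many digits vanish. The integer `0` has all digits `0`. -/
structure IsOstrowskiExpansion (α : ℝ) (n : ℕ) (c : ℕ → ℕ) : Prop where
  first_lt : c 0 < partialQuotient α 1
  digit_le : ∀ k, 1 ≤ k → c k ≤ partialQuotient α (k + 1)
  carry : ∀ k, c (k + 1) = partialQuotient α (k + 2) → c k = 0
  sum_eq : ∃ M : ℕ, (∀ k, M < k → c k = 0) ∧
    n = ∑ k ∈ Finset.range (M + 1), c k * convergentDen α k

/-- The set `A(m)` of non-negative integers whose Ostrowski expansion has the form
`n = ∑_{k ≥ m} c_{k+1} q_k`. -/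
def ostrowskiTail (α : ℝ) (m : ℕ) : Set ℕ :=
  {n | ∃ c : ℕ → ℕ, IsOstrowskiExpansion α n c ∧ ∀ k, k < m → c k = 0}

/-! ### Special intervals -/

/-- The special interval `J(m, γ) = γ + closure {n α : n ∈ A(m)}` in `ℝ/ℤ`. -/
def specialInterval (α : ℝ) (m : ℕ) (γ : UnitAddCircle) : Set UnitAddCircle :=
  (fun t => γ + t) '' closure ((fun n : ℕ => (((n : ℝ) * α : ℝ) : UnitAddCircle)) ''
    ostrowskiTail α m)

/-- The hyperplane `V` is the graph `y_j = ∑_{i ≠ j} a_i y_i` over the coordinates other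
than `j`. For a given `V` of codimension one, such slopes `a_i` exist exactly when the standard
basis vector `e_j` is not in `V`, and then they are unique for `i ≠ j`. -/
def IsGraph {k : ℕ} (V : Submodule ℝ (EuclideanSpace ℝ (Fin k))) (j : Fin k)
    (a : Fin k → ℝ) : Prop :=
  ∀ y : EuclideanSpace ℝ (Fin k), y ∈ V ↔ y j = ∑ i ∈ Finset.univ.erase j, a i * y i

/-- `T ⊆ ℝ/ℤ` is a special interval for `V`, as a window in the direction `e_j`: up to
its end points, which may or may not belong to `T`, it is `J(m, γ)` with `m ≥ 1` for
`α = {a_i}`, where `a_i` is some irrational slope of `V`. -/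
def IsSpecialIntervalFor {k : ℕ} (V : Submodule ℝ (EuclideanSpace ℝ (Fin k))) (j : Fin k)
    (T : Set UnitAddCircle) : Prop :=
  ∃ a : Fin k → ℝ, IsGraph V j a ∧
    ∃ i : Fin k, i ≠ j ∧ Irrational (a i) ∧
      ∃ m : ℕ, 1 ≤ m ∧ ∃ γ : UnitAddCircle,
        interior (specialInterval (Int.fract (a i)) m γ) ⊆ T ∧
          T ⊆ specialInterval (Int.fract (a i)) m γ

/-! ### Cut-and-project sets -/

/-- The subgroup `ℤ^k` of `ℝ^k`. -/
def integerPoints (k : ℕ) : AddSubgroup (EuclideanSpace ℝ (Fin k)) where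
  carrier := {v | ∀ i, ∃ n : ℤ, v i = n}
  zero_mem' := fun _ => ⟨0, by simp⟩
  add_mem' := by
    intro u v hu hv i
    obtain ⟨m, hm⟩ := hu i
    obtain ⟨n, hn⟩ := hv i
    exact ⟨m + n, by simp [hm, hn]⟩
  neg_mem' := by
    intro u hu i
    obtain ⟨m, hm⟩ := hu i
    exact ⟨-m, by simp [hm]⟩

/-- The torus `ℝ^k / ℤ^k`. -/
abbrev Torus (k : ℕ) : Type := EuclideanSpace ℝ (Fin k) ⧸ integerPoints k

/-- The canonical projection `π : ℝ^k → ℝ^k / ℤ^k`. -/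
def proj (k : ℕ) (v : EuclideanSpace ℝ (Fin k)) : Torus k := QuotientAddGroup.mk v

/-- The cut-and-project set `Y_{S,x} = {v ∈ V : π(v + x) ∈ S}`. -/
def cutAndProject {k : ℕ} (V : Submodule ℝ (EuclideanSpace ℝ (Fin k))) (S : Set (Torus k))
    (x : EuclideanSpace ℝ (Fin k)) : Set V :=
  {v | proj k ((v : EuclideanSpace ℝ (Fin k)) + x) ∈ S}

/-- The window `S = π({p + t e_j : t mod 1 ∈ T})` on the line through `p` parallel to `e_j`.
Since `e_j ∈ ℤ^k`, if `T` is the image in `ℝ/ℤ` of `I ⊆ ℝ`, this is `π({p + t e_j : t ∈ I})`. -/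
def window {k : ℕ} (j : Fin k) (p : EuclideanSpace ℝ (Fin k)) (T : Set UnitAddCircle) :
    Set (Torus k) :=
  (fun t : ℝ => proj k (p + t • EuclideanSpace.single j (1 : ℝ))) ''
    {t : ℝ | (t : UnitAddCircle) ∈ T}

end

end CutProject

/-! The point is Kesten's phenomenon: for a rotation by an irrational a and an arc of length ℓ = A +
B a with A, B coprime, the hitting times stay within bounded distance of ℓ⁻¹ℤ. Encode a hit as (n,
p) with n a + c - p in the half-open arc. The homomorphism (n, p) ↦ A n + B p is onto ℤ with kernel
generated by (B, -A), and a step along the kernel moves n a + c - p by exactly ℓ. Hence each fibre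
contains exactly one hit, so hits are enumerated by ℤ; up to a constant the value differs from ℓ n
by at most |B| ℓ (`exists_bijOn_halfOpen`).

Special intervals are such arcs. The Ostrowski digits sweep out an arc of length E + F, with E, F
consecutive approximation gaps; its coefficients are differences of consecutive convergents, which
makes them coprime and gives |B| ℓ ≤ 2 (`specialInterval_eq_image`, `specialInterval_arc`). This
uniform bound is what makes the final constant depend on V alone.

In the coordinates other than the j-th, the cut-and-project set is a translate of a set of integer
vectors. Along each row in direction i₀ that set is a set of hitting times, so enumerating every row
gives a bijection to ℤ^(k-1), and hence to the lattice with spacing ℓ⁻¹ in direction i₀ and 1 in the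
others (`IsGraph.exists_lattice_bijection`). -/

namespace CutProject

open Set

/-! ### Convergents -/

/-- The numerators `p_k` of the principal convergents of `α ∈ (0, 1)`. -/
noncomputable def convergentNum (α : ℝ) : ℕ → ℕ
  | 0 => 0
  | 1 => 1
  | k + 2 => partialQuotient α (k + 2) * convergentNum α (k + 1) + convergentNum α k

/-- The signed approximation error `(-1)^k (q_k α - p_k)`, which is positive for irrational
`α ∈ (0, 1)`. -/
noncomputable def approxGap (α : ℝ) (k : ℕ) : ℝ :=
  (-1) ^ k * (convergentDen α k * α - convergentNum α k)

theorem irrational_completeQuotient {α : ℝ} (hα : Irrational α) (k : ℕ) :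
    Irrational (completeQuotient α k) := by
  induction k with
  | zero => exact hα
  | succ k ih =>
    have h : Irrational (Int.fract (completeQuotient α k)) := by
      rw [Int.fract]
      exact ih.sub_intCast _
    exact h.inv

theorem fract_pos_of_irrational {x : ℝ} (hx : Irrational x) : 0 < Int.fract x := by
  refine lt_of_le_of_ne (Int.fract_nonneg x) fun h => hx.ne_int ⌊x⌋ ?_
  have := Int.self_sub_floor x
  linarith

theorem one_lt_completeQuotient {α : ℝ} (hα : Irrational α) (k : ℕ) :
    1 < completeQuotient α (k + 1) :=
  (one_lt_inv₀ (fract_pos_of_irrational (irrational_completeQuotient hα k))).2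
    (Int.fract_lt_one _)

theorem one_le_partialQuotient {α : ℝ} (hα : Irrational α) (k : ℕ) :
    1 ≤ partialQuotient α (k + 1) :=
  (Nat.one_le_floor_iff _).2 (one_lt_completeQuotient hα k).le

theorem partialQuotient_add_fract {α : ℝ} (hα : Irrational α) (k : ℕ) :
    (partialQuotient α (k + 1) : ℝ) + Int.fract (completeQuotient α (k + 1)) =
      completeQuotient α (k + 1) := by
  have h0 : (0 : ℝ) ≤ completeQuotient α (k + 1) :=
    zero_le_one.trans (one_lt_completeQuotient hα k).le
  have h := natCast_floor_eq_intCast_floor h0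
  rw [partialQuotient, h, Int.floor_add_fract]

theorem approxGap_zero (α : ℝ) : approxGap α 0 = α := by
  simp [approxGap, convergentDen, convergentNum]

theorem approxGap_add_two (α : ℝ) (k : ℕ) :
    approxGap α k = partialQuotient α (k + 2) * approxGap α (k + 1) + approxGap α (k + 2) := by
  simp only [approxGap, convergentDen, convergentNum]
  push_cast
  ring

theorem one_le_convergentDen {α : ℝ} (hα : Irrational α) (k : ℕ) : 1 ≤ convergentDen α k ∧
    convergentDen α k ≤ convergentDen α (k + 1) := by
  induction k with
  | zero => exact ⟨le_rfl, one_le_partialQuotient hα 0⟩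
  | succ k ih =>
    refine ⟨ih.1.trans ih.2, ?_⟩
    rw [convergentDen]
    have := Nat.le_mul_of_pos_left (convergentDen α (k + 1)) (one_le_partialQuotient hα (k + 1))
    exact this.trans (Nat.le_add_right _ _)

theorem convergentDen_mul_approxGap (α : ℝ) (k : ℕ) :
    convergentDen α (k + 1) * approxGap α k + convergentDen α k * approxGap α (k + 1) = 1 := by
  induction k with
  | zero =>
    simp only [approxGap, convergentDen, convergentNum]
    push_cast
    ring
  | succ k ih =>
    have h := approxGap_add_two α k
    rw [convergentDen]
    push_cast
    rw [h] at ih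
    linear_combination ih

theorem convergent_det (α : ℝ) (k : ℕ) :
    (convergentDen α k : ℤ) * convergentNum α (k + 1) -
      convergentDen α (k + 1) * convergentNum α k = (-1) ^ k := by
  induction k with
  | zero => simp [convergentDen, convergentNum]
  | succ k ih =>
    rw [convergentDen, convergentNum, pow_succ, ← ih]
    push_cast
    ring

/-- The Gauss map renormalises consecutive gaps; positivity and monotonicity of the gaps follow. -/
theorem approxGap_succ {α : ℝ} (hα : Irrational α) (h0 : 0 < α) (h1 : α < 1)
    (k : ℕ) :
    approxGap α (k + 1) = approxGap α k * Int.fract (completeQuotient α (k + 1)) := by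
  induction k with
  | zero =>
    have h := partialQuotient_add_fract hα 0
    have hz : completeQuotient α 1 = α⁻¹ := by
      simp [completeQuotient, Int.fract_eq_self.2 ⟨h0.le, h1⟩]
    rw [approxGap_zero, eq_sub_of_add_eq' h]
    simp only [zero_add, hz, approxGap, convergentDen, convergentNum]
    field_simp
    push_cast
    ring
  | succ k ih =>
    have h := partialQuotient_add_fract hα (k + 1)
    have hf := fract_pos_of_irrational (irrational_completeQuotient hα (k + 1))
    have hz : approxGap α k = approxGap α (k + 1) * completeQuotient α (k + 2) := by
      rw [ih, show completeQuotient α (k + 2) = (Int.fract (completeQuotient α (k + 1)))⁻¹ from rfl,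
        mul_assoc, mul_inv_cancel₀ hf.ne', mul_one]
    have h2 := approxGap_add_two α k
    rw [hz, ← h] at h2
    linarith

theorem approxGap_pos {α : ℝ} (hα : Irrational α) (h0 : 0 < α) (h1 : α < 1)
    (k : ℕ) : 0 < approxGap α k := by
  induction k with
  | zero => rwa [approxGap_zero]
  | succ k ih =>
    rw [approxGap_succ hα h0 h1]
    exact mul_pos ih (fract_pos_of_irrational (irrational_completeQuotient hα _))

theorem approxGap_succ_le {α : ℝ} (hα : Irrational α) (h0 : 0 < α) (h1 : α < 1)
    (k : ℕ) : approxGap α (k + 1) ≤ approxGap α k := by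
  rw [approxGap_succ hα h0 h1]
  exact mul_le_of_le_one_right (approxGap_pos hα h0 h1 k).le (Int.fract_lt_one _).le

theorem approxGap_add_two_le {α : ℝ} (hα : Irrational α) (h0 : 0 < α) (h1 : α < 1)
    (k : ℕ) : approxGap α (k + 2) ≤ approxGap α k / 2 := by
  have h := approxGap_add_two α k
  have ha : (1 : ℝ) ≤ partialQuotient α (k + 2) := by
    exact_mod_cast one_le_partialQuotient hα (k + 1)
  have := le_mul_of_one_le_left (approxGap_pos hα h0 h1 (k + 1)).le ha
  have := approxGap_succ_le hα h0 h1 (k + 1)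
  linarith

theorem exists_approxGap_lt {α : ℝ} (hα : Irrational α) (h0 : 0 < α) (h1 : α < 1)
    (l : ℕ) {δ : ℝ} (hδ : 0 < δ) : ∃ N, approxGap α (l + N) < δ := by
  have key : ∀ N, approxGap α (l + 2 * N) ≤ approxGap α l * (1 / 2) ^ N := by
    intro N
    induction N with
    | zero => simp
    | succ N ih =>
      have h := approxGap_add_two_le hα h0 h1 (l + 2 * N)
      rw [pow_succ]
      have e : l + 2 * (N + 1) = l + 2 * N + 2 := by ring
      rw [e]
      linarith
  have hp := approxGap_pos hα h0 h1 l
  obtain ⟨N, hN⟩ := exists_pow_lt_of_lt_one (div_pos hδ hp) (by norm_num : (1 / 2 : ℝ) < 1)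
  refine ⟨2 * N, (key N).trans_lt ?_⟩
  rw [lt_div_iff₀ hp] at hN
  linarith

/-! ### Ostrowski digits -/

/-- Splitting off the first digit leaves minus a sum of the same kind one level up, and
`approxGap_add_two` matches the two intervals. The carry rule plays no role in this bound. -/
theorem digitSum_mem_Icc {α : ℝ} (hα : Irrational α) (h0 : 0 < α) (h1 : α < 1)
    {c : ℕ → ℕ} (hc : ∀ k, c k ≤ partialQuotient α (k + 1)) (N l : ℕ) :
    ∑ i ∈ Finset.range N, (-1) ^ i * (c (l + 1 + i) * approxGap α (l + 1 + i)) ∈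
      Icc (-approxGap α (l + 1)) (approxGap α l) := by
  induction N generalizing l with
  | zero => simp [(approxGap_pos hα h0 h1 _).le]
  | succ N ih =>
    have hs : ∑ i ∈ Finset.range (N + 1), (-1) ^ i * (c (l + 1 + i) * approxGap α (l + 1 + i)) =
        c (l + 1) * approxGap α (l + 1) - ∑ i ∈ Finset.range N,
          (-1) ^ i * (c (l + 1 + 1 + i) * approxGap α (l + 1 + 1 + i)) := by
      rw [Finset.sum_range_succ', sub_eq_neg_add, ← Finset.sum_neg_distrib]
      congr 1
      · refine Finset.sum_congr rfl fun i _ => ?_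
        rw [show l + 1 + (i + 1) = l + 1 + 1 + i by ring, pow_succ]
        ring
      · simp
    obtain ⟨ha, hb⟩ := ih (l + 1)
    have hp := approxGap_pos hα h0 h1 (l + 1)
    have hd : (c (l + 1) : ℝ) * approxGap α (l + 1) ≤
        partialQuotient α (l + 2) * approxGap α (l + 1) := by
      gcongr
      exact hc (l + 1)
    have hn : 0 ≤ (c (l + 1) : ℝ) * approxGap α (l + 1) := by positivity
    have h2 := approxGap_add_two α l
    rw [hs]
    constructor <;> linarith

/-- Greedy expansion. The fourth conclusion strengthens the induction: it turns the bound on the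
remainder after a nonzero digit into the carry rule. -/
theorem exists_digits {α : ℝ} (hα : Irrational α) (h0 : 0 < α) (h1 : α < 1)
    (N l : ℕ) (y : ℝ) (hy : y ∈ Icc (-approxGap α (l + 1)) (approxGap α l)) :
    ∃ c : ℕ → ℕ, (∀ i, N ≤ i → c i = 0) ∧ (∀ i, c i ≤ partialQuotient α (l + 2 + i)) ∧
      (∀ i, c (i + 1) = partialQuotient α (l + 3 + i) → c i = 0) ∧
      (y ≤ approxGap α l - approxGap α (l + 1) → c 0 < partialQuotient α (l + 2)) ∧
      |∑ i ∈ Finset.range N, (-1) ^ i * (c i * approxGap α (l + 1 + i)) - y| ≤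
        approxGap α (l + N) := by
  induction N generalizing l y with
  | zero =>
    refine ⟨fun _ => 0, by simp, by simp, by simp,
      fun _ => one_le_partialQuotient hα (l + 1), ?_⟩
    have := approxGap_succ_le hα h0 h1 l
    simp only [Finset.range_zero, Finset.sum_empty, zero_sub, abs_neg, add_zero, abs_le]
    exact ⟨by linarith [hy.1], hy.2⟩
  | succ N ih =>
    have hp := approxGap_pos hα h0 h1 (l + 1)
    have h2 := approxGap_add_two α l
    -- The least digit whose remainder d θ_{l+1} - y is at least -θ_{l+2}, where θ denotes
    -- `approxGap`.
    set d := ⌈(y - approxGap α (l + 2)) / approxGap α (l + 1)⌉₊ with hd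
    have hle : y - approxGap α (l + 2) ≤ d * approxGap α (l + 1) := by
      rw [← div_le_iff₀ hp]
      exact Nat.le_ceil _
    have hlt : d ≠ 0 → d * approxGap α (l + 1) - y < approxGap α (l + 1) - approxGap α (l + 2) := by
      intro hne
      have hpos : 0 ≤ (y - approxGap α (l + 2)) / approxGap α (l + 1) :=
        (Nat.ceil_pos.1 (Nat.pos_of_ne_zero hne)).le
      have h := Nat.ceil_lt_add_one hpos
      rw [← hd, ← sub_lt_iff_lt_add, lt_div_iff₀ hp] at h
      linarith
    have hmem : d * approxGap α (l + 1) - y ∈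
        Icc (-approxGap α (l + 1 + 1)) (approxGap α (l + 1)) := by
      refine ⟨by linarith, ?_⟩
      rcases eq_or_ne d 0 with h | h
      · rw [h]
        simpa using neg_le.1 hy.1
      · linarith [hlt h, approxGap_pos hα h0 h1 (l + 2)]
    obtain ⟨c, hc0, hca, hcc, hcr, hcs⟩ := ih (l + 1) _ hmem
    refine ⟨fun i => Nat.casesOn i d c, ?_, ?_, ?_, ?_, ?_⟩
    · rintro (_ | i) hi
      · omega
      · exact hc0 i (by omega)
    · rintro (_ | i)
      · refine Nat.ceil_le.2 ?_
        rw [div_le_iff₀ hp]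
        simp only [add_zero]
        linarith [hy.2]
      · have := hca i
        rwa [show l + 1 + 2 + i = l + 2 + (i + 1) by ring] at this
    · rintro (_ | i) hi
      · by_contra hne
        exact (hcr (hlt hne).le).ne hi
      · refine hcc i ?_
        rwa [show l + 1 + 3 + i = l + 3 + (i + 1) by ring]
    · intro hy'
      have ha : 1 ≤ partialQuotient α (l + 2) := one_le_partialQuotient hα (l + 1)
      have : d ≤ partialQuotient α (l + 2) - 1 := by
        refine Nat.ceil_le.2 ?_
        rw [div_le_iff₀ hp, Nat.cast_sub ha]
        push_cast
        linarith
      show d < partialQuotient α (l + 2)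
      omega
    · rw [Finset.sum_range_succ']
      have hs : ∑ i ∈ Finset.range N, (-1 : ℝ) ^ (i + 1) * (c i * approxGap α (l + 1 + (i + 1))) =
          -∑ i ∈ Finset.range N, (-1 : ℝ) ^ i * (c i * approxGap α (l + 1 + 1 + i)) := by
        rw [← Finset.sum_neg_distrib]
        refine Finset.sum_congr rfl fun i _ => ?_
        rw [show l + 1 + (i + 1) = l + 1 + 1 + i by ring, pow_succ]
        ring
      simp only [hs]
      rw [show l + (N + 1) = l + 1 + N by ring, abs_sub_comm]
      convert hcs using 2
      simp
      ring

end CutProject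

namespace CutProject

open Set

/-! ### Special intervals are arcs -/

/-- Modulo 1, n α is the alternating digit sum of the gaps. Digit sums stay in the interval, and
greedy expansions approximate each of its points. Since m = l + 1 ≥ 1, the first digit is zero and
its stricter bound is harmless. -/
theorem specialInterval_eq_image {α : ℝ} (hα : Irrational α) (h0 : 0 < α) (h1 : α < 1) (l : ℕ)
    (γ : UnitAddCircle) :
    specialInterval α (l + 1) γ = (fun y : ℝ => γ + (((-1) ^ (l + 1) * y : ℝ) : UnitAddCircle)) ''
      Icc (-approxGap α (l + 1)) (approxGap α l) := by
  have hcont : Continuous fun y : ℝ => (((-1) ^ (l + 1) * y : ℝ) : UnitAddCircle) :=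
    (AddCircle.continuous_mk' (1 : ℝ)).comp (continuous_const.mul continuous_id)
  have hval : ∀ (c : ℕ → ℕ) (N : ℕ), (∀ k, k < l + 1 → c k = 0) →
      ((((∑ k ∈ Finset.range (l + 1 + N), c k * convergentDen α k : ℕ) : ℝ) * α : ℝ) :
          UnitAddCircle) =
        (((-1) ^ (l + 1) * ∑ i ∈ Finset.range N,
          (-1) ^ i * (c (l + 1 + i) * approxGap α (l + 1 + i)) : ℝ) : UnitAddCircle) := by
    intro c N hc
    have hz : ∑ k ∈ Finset.range (l + 1), c k * convergentDen α k = 0 :=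
      Finset.sum_eq_zero fun k hk => by rw [hc k (by simpa using hk), zero_mul]
    rw [Finset.sum_range_add, hz, zero_add, ← sub_eq_zero, ← AddCircle.coe_sub,
      AddCircle.coe_eq_zero_iff]
    -- The two real numbers differ by the same digit sum of the numerators.
    refine ⟨(∑ i ∈ Finset.range N, c (l + 1 + i) * convergentNum α (l + 1 + i) : ℕ), ?_⟩
    push_cast
    rw [zsmul_one, Finset.sum_mul, Finset.mul_sum, ← Finset.sum_sub_distrib]
    push_cast
    refine Finset.sum_congr rfl fun i _ => ?_
    have hs : ((-1 : ℝ) ^ (l + 1)) * ((-1) ^ i * (-1) ^ (l + 1 + i)) = 1 := by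
      rw [← pow_add, ← pow_add]
      exact Even.neg_one_pow ⟨l + 1 + i, by ring⟩
    rw [approxGap]
    linear_combination c (l + 1 + i) * (convergentDen α (l + 1 + i) * α -
      convergentNum α (l + 1 + i)) * hs
  suffices closure ((fun n : ℕ => (((n : ℝ) * α : ℝ) : UnitAddCircle)) '' ostrowskiTail α (l + 1)) =
      (fun y : ℝ => (((-1) ^ (l + 1) * y : ℝ) : UnitAddCircle)) ''
        Icc (-approxGap α (l + 1)) (approxGap α l) by
    rw [specialInterval, this, image_image]
  apply Subset.antisymm
  · refine closure_minimal ?_ (isCompact_Icc.image hcont).isClosed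
    rintro _ ⟨n, ⟨c, hc, hc0⟩, rfl⟩
    obtain ⟨M, hM, rfl⟩ := hc.sum_eq
    have hext : ∑ k ∈ Finset.range (M + 1), c k * convergentDen α k =
        ∑ k ∈ Finset.range (l + 1 + (M + 1)), c k * convergentDen α k := by
      refine Finset.sum_subset (Finset.range_mono (by omega)) fun k _ hk => ?_
      rw [hM k (by simpa using hk), zero_mul]
    have hle : ∀ k, c k ≤ partialQuotient α (k + 1) := by
      rintro (_ | k)
      · exact hc.first_lt.le
      · exact hc.digit_le _ (by omega)
    refine ⟨_, digitSum_mem_Icc hα h0 h1 hle (M + 1) l, ?_⟩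
    simp only
    rw [hext, hval c (M + 1) hc0]
  · rintro _ ⟨y, hy, rfl⟩
    have hcl : y ∈ closure ((fun y : ℝ => (((-1) ^ (l + 1) * y : ℝ) : UnitAddCircle)) ⁻¹'
        ((fun n : ℕ => (((n : ℝ) * α : ℝ) : UnitAddCircle)) '' ostrowskiTail α (l + 1))) := by
      rw [Metric.mem_closure_iff]
      intro δ hδ
      obtain ⟨N, hN⟩ := exists_approxGap_lt hα h0 h1 l hδ
      obtain ⟨c, hc0, hca, hcc, -, hcs⟩ := exists_digits hα h0 h1 N l y hy
      let c' : ℕ → ℕ := fun k => if k < l + 1 then 0 else c (k - (l + 1))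
      have hc'0 : ∀ k, k < l + 1 → c' k = 0 := fun k hk => if_pos hk
      have hc'1 : ∀ i, c' (l + 1 + i) = c i := fun i => by
        simp only [c']
        rw [if_neg (by omega), Nat.add_sub_cancel_left]
      refine ⟨∑ i ∈ Finset.range N, (-1) ^ i * (c i * approxGap α (l + 1 + i)),
        ⟨_, ⟨c', ⟨?_, ?_, ?_, l + N, ?_, rfl⟩, hc'0⟩, ?_⟩, ?_⟩
      · rw [hc'0 0 (by omega)]
        exact one_le_partialQuotient hα 0
      · intro k _
        rcases lt_or_ge k (l + 1) with h | h
        · rw [hc'0 k h]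
          exact Nat.zero_le _
        · obtain ⟨i, rfl⟩ := Nat.exists_eq_add_of_le h
          rw [hc'1, show l + 1 + i + 1 = l + 2 + i by ring]
          exact hca i
      · intro k hk
        rcases lt_or_ge k (l + 1) with h | h
        · exact hc'0 k h
        · obtain ⟨i, rfl⟩ := Nat.exists_eq_add_of_le h
          rw [hc'1]
          refine hcc i ?_
          rwa [add_assoc, hc'1, show l + 1 + i + 2 = l + 3 + i by ring] at hk
      · intro k hk
        obtain ⟨i, rfl⟩ := Nat.exists_eq_add_of_le (show l + 1 ≤ k by omega)
        rw [hc'1]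
        exact hc0 i (by omega)
      · simp only
        rw [show l + N + 1 = l + 1 + N by ring, hval c' N hc'0]
        simp only [hc'1]
      · rw [dist_comm, Real.dist_eq]
        exact hcs.trans_lt hN
    have := image_closure_subset_closure_image hcont (mem_image_of_mem _ hcl)
    exact closure_mono (image_preimage_subset _ _) this

/-- A special interval is an arc of length `A + B α`, with `A` and `B` coprime and `B`
controlled by the length. -/
theorem specialInterval_arc {α : ℝ} (hα : Irrational α) (h0 : 0 < α) (h1 : α < 1) {m : ℕ}
    (hm : 1 ≤ m) (γ : UnitAddCircle) :
    ∃ (A B : ℤ) (lo : ℝ), IsCoprime A B ∧ 0 < A + B * α ∧ A + B * α ≤ 1 ∧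
      |(B : ℝ)| * (A + B * α) ≤ 2 ∧
      (fun t : ℝ => (t : UnitAddCircle)) '' Ioo lo (lo + (A + B * α)) ⊆
        interior (specialInterval α m γ) ∧
      specialInterval α m γ ⊆ (fun t : ℝ => (t : UnitAddCircle)) '' Icc lo (lo + (A + B * α)) := by
  obtain ⟨l, rfl⟩ := Nat.exists_eq_add_of_le' hm
  obtain ⟨γ, rfl⟩ := QuotientAddGroup.mk_surjective γ
  set ε : ℤ := (-1) ^ (l + 1) with hε
  have hε1 : ε * ε = 1 := by
    rw [hε, ← mul_pow]
    norm_num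
  set E := approxGap α l with hE
  set F := approxGap α (l + 1) with hF
  have hE0 : 0 < E := approxGap_pos hα h0 h1 l
  have hF0 : 0 < F := approxGap_pos hα h0 h1 (l + 1)
  have hFE : F ≤ E := approxGap_succ_le hα h0 h1 l
  have hid := convergentDen_mul_approxGap α l
  have hdet := convergent_det α l
  obtain ⟨hq1, hq2⟩ := one_le_convergentDen hα l
  have hlen : ((-ε * ((convergentNum α (l + 1) : ℤ) - convergentNum α l) : ℤ) : ℝ) +
      (ε * ((convergentDen α (l + 1) : ℤ) - convergentDen α l) : ℤ) * α = E + F := by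
    rw [hE, hF, approxGap, approxGap, hε]
    push_cast
    ring
  have hq1' : (1 : ℝ) ≤ convergentDen α l := by exact_mod_cast hq1
  have hq2' : (convergentDen α l : ℝ) ≤ convergentDen α (l + 1) := by exact_mod_cast hq2
  have himg : specialInterval α (l + 1) (γ : UnitAddCircle) =
      (fun t : ℝ => (t : UnitAddCircle)) '' ((fun y : ℝ => γ + ε * y) '' Icc (-F) E) := by
    rw [specialInterval_eq_image hα h0 h1, image_image]
    simp [hε]
    rfl
  refine ⟨-ε * ((convergentNum α (l + 1) : ℤ) - convergentNum α l),
    ε * ((convergentDen α (l + 1) : ℤ) - convergentDen α l), ?_⟩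
  rw [hlen]
  have hcases : ∃ lo, (fun y : ℝ => γ + ε * y) '' Icc (-F) E = Icc lo (lo + (E + F)) := by
    rcases Int.isUnit_iff.1 (IsUnit.of_mul_eq_one ε hε1) with h | h
    · refine ⟨γ - F, ?_⟩
      rw [h]
      simp
      congr 1 <;> ring
    · refine ⟨γ - E, ?_⟩
      rw [h]
      simp [← sub_eq_add_neg]
      congr 1
      ring
  obtain ⟨lo, hlo⟩ := hcases
  refine ⟨lo, ?_, by positivity, ?_, ?_, ?_, ?_⟩
  -- The Bézout combination with q_l and p_l is -ε times the determinant (-1)^l = -ε of the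
  -- convergents.
  · refine ⟨convergentDen α l, convergentNum α l, ?_⟩
    have hε2 : (-1 : ℤ) ^ l = -ε := by rw [hε, pow_succ]; ring
    rw [hε2] at hdet
    linear_combination hε1 - ε * hdet
  · nlinarith
  -- |B| ≤ q_{l+1}, while q_{l+1} E ≤ 1 by `hid` and F ≤ E; hence the bound 2.
  · have : |((ε * ((convergentDen α (l + 1) : ℤ) - convergentDen α l) : ℤ) : ℝ)| ≤
        convergentDen α (l + 1) := by
      have he : |(ε : ℝ)| = 1 := by
        rw [hε]
        simp
      push_cast
      rw [abs_mul, he, one_mul, abs_le]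
      constructor <;> linarith
    refine (mul_le_mul_of_nonneg_right this (by positivity)).trans ?_
    nlinarith
  · refine interior_maximal ?_ (QuotientAddGroup.isOpenMap_coe _ isOpen_Ioo)
    rw [himg, hlo]
    exact image_mono Ioo_subset_Icc_self
  · rw [himg, hlo]

/-! ### Integers hitting a half-open arc -/

/-- Each fibre of (n, p) ↦ A n + B p is a coset of ℤ(B, -A), on which n a + c - p runs through a
progression of step ℓ; it meets a half-open interval of length ℓ exactly once. -/
theorem exists_bijOn_halfOpen {a lo : ℝ} {A B : ℤ} (hAB : IsCoprime A B)
    (hl0 : 0 < A + B * a) (hl1 : A + B * a ≤ 1) (hB : |(B : ℝ)| * (A + B * a) ≤ 2) (c : ℝ) :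
    ∃ g : ℤ → ℤ, BijOn g {n : ℤ | ∃ p : ℤ, n * a + c - p ∈ Ico lo (lo + (A + B * a))} univ ∧
      ∀ n ∈ {n : ℤ | ∃ p : ℤ, n * a + c - p ∈ Ico lo (lo + (A + B * a))},
        |(g n : ℝ) - (A + B * a) * n| ≤ 3 := by
  set ℓ : ℝ := A + B * a with hℓ
  have hfl : ∀ n p : ℤ, n * a + c - p ∈ Ico lo (lo + ℓ) → ⌊n * a + c - lo⌋ = p := by
    intro n p h
    rw [Int.floor_eq_iff]
    constructor <;> linarith [h.1, h.2]
  -- Subtracting this integer keeps the displacement bounded uniformly in c: at most |B| ℓ + 1/2 ≤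
  -- 3.
  set R := round (B * (c - lo)) with hR
  refine ⟨fun n => A * n + B * ⌊n * a + c - lo⌋ - R, ⟨fun _ _ => mem_univ _, ?_, ?_⟩, ?_⟩
  · rintro n ⟨p, hp⟩ n' ⟨p', hp'⟩ h
    simp only [hfl n p hp, hfl n' p' hp'] at h
    have h2 : A * (n - n') = B * (p' - p) := by linear_combination h
    obtain ⟨s, hs⟩ : B ∣ n - n' := hAB.symm.dvd_of_dvd_mul_left ⟨_, h2⟩
    rcases eq_or_ne B 0 with hB0 | hB0
    · rw [hB0, zero_mul] at hs
      linarith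
    have hs2 : p' - p = A * s := by
      apply mul_left_cancel₀ hB0
      rw [← h2, hs]
      ring
    have hsR : (n : ℝ) - n' = B * s := by exact_mod_cast hs
    have hs2R : (p' : ℝ) - p = A * s := by exact_mod_cast hs2
    have hd : (n * a + c - p) - (n' * a + c - p') = s * ℓ := by
      rw [hℓ]
      linear_combination a * hsR + hs2R
    have hs0 : |(s : ℝ)| < 1 := by
      have : |(s : ℝ) * ℓ| < 1 * ℓ := by
        rw [← hd, abs_lt]
        constructor <;> linarith [hp.1, hp.2, hp'.1, hp'.2]
      rwa [abs_mul, abs_of_pos hl0, mul_lt_mul_iff_left₀ hl0] at this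
    have : s = 0 := Int.abs_lt_one_iff.1 (by exact_mod_cast hs0)
    rw [this, mul_zero] at hs
    linarith
  · intro r _
    obtain ⟨u, v, huv⟩ := hAB
    obtain ⟨s, hs, -⟩ := existsUnique_add_zsmul_mem_Ico hl0
      (((r + R) * u : ℤ) * a + c - ((r + R) * v : ℤ)) lo
    have key : (((r + R) * u + B * s : ℤ) : ℝ) * a + c - ((r + R) * v - A * s : ℤ) ∈
        Ico lo (lo + ℓ) := by
      convert hs using 1
      rw [hℓ, zsmul_eq_mul]
      push_cast
      ring
    refine ⟨(r + R) * u + B * s, ⟨_, key⟩, ?_⟩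
    simp only [hfl _ _ key]
    linear_combination (r + R) * huv
  · rintro n ⟨p, hp⟩
    simp only [hfl n p hp]
    have hr : |B * (c - lo) - R| ≤ 1 / 2 := abs_sub_round _
    have hy : |(B : ℝ) * (lo - (n * a + c - p))| ≤ 2 := by
      rw [abs_mul]
      refine (mul_le_mul_of_nonneg_left ?_ (abs_nonneg _)).trans hB
      rw [abs_le]
      constructor <;> linarith [hp.1, hp.2]
    have e : ((A * n + B * p - R : ℤ) : ℝ) - ℓ * n =
        B * (lo - (n * a + c - p)) + (B * (c - lo) - R) := by
      rw [hℓ]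
      push_cast
      ring
    rw [e]
    exact (abs_add_le _ _).trans (by linarith)

/-! ### Adding and removing a point -/

/-- Values from r upwards move by one to free r for the new point. -/
theorem bijOn_insert_shift {H : Set ℤ} {g : ℤ → ℤ} (hg : BijOn g H univ) {n₀ : ℤ} (h₀ : n₀ ∉ H)
    (r : ℤ) : BijOn (fun n => if n = n₀ then r else if g n < r then g n else g n + 1)
      (insert n₀ H) univ := by
  refine ⟨fun _ _ => mem_univ _, ?_, fun z _ => ?_⟩
  · intro x hx y hy hxy
    have hxy' := fun (h : x ∈ H) (h' : y ∈ H) => hg.injOn h h'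
    grind
  · rcases lt_trichotomy z r with h | h | h
    · obtain ⟨n, hn, rfl⟩ := hg.surjOn (mem_univ z)
      exact ⟨n, .inr hn, by grind⟩
    · exact ⟨n₀, .inl rfl, by simp [h]⟩
    · obtain ⟨n, hn, hz⟩ := hg.surjOn (mem_univ (z - 1))
      exact ⟨n, .inr hn, by grind⟩

theorem bijOn_diff_singleton_shift {H : Set ℤ} {g : ℤ → ℤ} (hg : BijOn g H univ) {n₀ : ℤ}
    (h₀ : n₀ ∈ H) : BijOn (fun n => if g n < g n₀ then g n else g n - 1) (H \ {n₀}) univ := by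
  refine ⟨fun _ _ => mem_univ _, ?_, fun z _ => ?_⟩
  · intro x hx y hy hxy
    have hxy' := hg.injOn hx.1 hy.1
    have hx0 := mt (hg.injOn hx.1 h₀) hx.2
    have hy0 := mt (hg.injOn hy.1 h₀) hy.2
    grind
  · rcases lt_or_ge z (g n₀) with h | h
    · obtain ⟨n, hn, rfl⟩ := hg.surjOn (mem_univ z)
      exact ⟨n, ⟨hn, by grind⟩, by grind⟩
    · obtain ⟨n, hn, hz⟩ := hg.surjOn (mem_univ (z + 1))
      exact ⟨n, ⟨hn, by grind⟩, by grind⟩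

/-- `g` enumerates `H ⊆ ℤ` by `ℤ`, at distance at most `C` from `n ↦ ℓ n`. -/
def IsEnumeration (ℓ C : ℝ) (H : Set ℤ) (g : ℤ → ℤ) : Prop :=
  BijOn g H univ ∧ ∀ n ∈ H, |(g n : ℝ) - ℓ * n| ≤ C

theorem exists_isEnumeration_insert {ℓ C : ℝ} {H : Set ℤ} {g : ℤ → ℤ} (hC : 0 ≤ C)
    (hg : IsEnumeration ℓ C H g) {n₀ : ℤ} (h₀ : n₀ ∉ H) :
    ∃ g', IsEnumeration ℓ (C + 1) (insert n₀ H) g' := by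
  refine ⟨_, bijOn_insert_shift hg.1 h₀ (round (ℓ * n₀)), ?_⟩
  rintro n (rfl | hn)
  · rw [if_pos rfl, abs_sub_comm]
    linarith [abs_sub_round (ℓ * n)]
  · have h := abs_le.1 (hg.2 n hn)
    rw [abs_le]
    split_ifs with h1 h2
    · exact absurd (h1 ▸ hn) h₀
    · constructor <;> linarith
    · push_cast
      constructor <;> linarith

theorem exists_isEnumeration_diff {ℓ C : ℝ} {H : Set ℤ} {g : ℤ → ℤ}
    (hg : IsEnumeration ℓ C H g) {n₀ : ℤ} (h₀ : n₀ ∈ H) :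
    ∃ g', IsEnumeration ℓ (C + 1) (H \ {n₀}) g' := by
  refine ⟨_, bijOn_diff_singleton_shift hg.1 h₀, ?_⟩
  rintro n ⟨hn, -⟩
  have h := abs_le.1 (hg.2 n hn)
  rw [abs_le]
  split_ifs
  · constructor <;> linarith
  · push_cast
    constructor <;> linarith

theorem IsEnumeration.mono {ℓ C C' : ℝ} {H : Set ℤ} {g : ℤ → ℤ} (hg : IsEnumeration ℓ C H g)
    (h : C ≤ C') : IsEnumeration ℓ C' H g :=
  ⟨hg.1, fun n hn => (hg.2 n hn).trans h⟩

theorem exists_isEnumeration_of_subsingleton_diff {ℓ C : ℝ} {H H' : Set ℤ} {g : ℤ → ℤ}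
    (hC : 0 ≤ C) (hg : IsEnumeration ℓ C H g) (h₁ : (H \ H').Subsingleton)
    (h₂ : (H' \ H).Subsingleton) : ∃ g', IsEnumeration ℓ (C + 2) H' g' := by
  have step : ∃ g', IsEnumeration ℓ (C + 1) (H ∪ H') g' := by
    rcases h₂.eq_empty_or_singleton with h | ⟨n₀, h⟩
    · rw [union_eq_self_of_subset_right (sdiff_eq_empty.1 h)]
      exact ⟨g, hg.mono (by linarith)⟩
    · have hn : n₀ ∈ H' \ H := by simp [h]
      rw [← union_sdiff_self, h, union_singleton]
      exact exists_isEnumeration_insert hC hg hn.2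
  obtain ⟨g₁, hg₁⟩ := step
  rcases h₁.eq_empty_or_singleton with h | ⟨n₀, h⟩
  · rw [union_eq_self_of_subset_left (sdiff_eq_empty.1 h)] at hg₁
    exact ⟨g₁, hg₁.mono (by linarith)⟩
  · have hn : n₀ ∈ H \ H' := by simp [h]
    have hH : H' = (H ∪ H') \ {n₀} := by
      rw [← h]
      ext x
      simp
      tauto
    rw [hH, show C + 2 = C + 1 + 1 by ring]
    exact exists_isEnumeration_diff hg₁ (.inl hn.1)

/-! ### Integers hitting an arc -/

theorem eq_of_mul_add_sub_eq {a c y : ℝ} (ha : Irrational a) {n n' p p' : ℤ}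
    (h : n * a + c - p = y) (h' : n' * a + c - p' = y) : n = n' := by
  by_contra hne
  refine (ha.intCast_mul (sub_ne_zero.2 hne)).ne_int (p - p') ?_
  push_cast
  linarith

/-- Passing from the half-open arc to T affects only hits at the end points. Irrationality allows at
most one hit at each, so at most one point is removed and one added, and the constant grows from 3
to 5. -/
theorem exists_isEnumeration_hits {a lo : ℝ} (ha : Irrational a) {A B : ℤ} (hAB : IsCoprime A B)
    (hl0 : 0 < A + B * a) (hl1 : A + B * a ≤ 1) (hB : |(B : ℝ)| * (A + B * a) ≤ 2)
    {T : Set UnitAddCircle}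
    (hT₁ : (fun t : ℝ => (t : UnitAddCircle)) '' Ioo lo (lo + (A + B * a)) ⊆ T)
    (hT₂ : T ⊆ (fun t : ℝ => (t : UnitAddCircle)) '' Icc lo (lo + (A + B * a))) (c : ℝ) :
    ∃ g, IsEnumeration (A + B * a) 5 {n : ℤ | ((n * a + c : ℝ) : UnitAddCircle) ∈ T} g := by
  have hcoe : ∀ x y : ℝ, (x : UnitAddCircle) = y → ∃ p : ℤ, y - p = x := by
    intro x y h
    rw [eq_comm, ← sub_eq_zero, ← AddCircle.coe_sub, AddCircle.coe_eq_zero_iff] at h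
    obtain ⟨p, hp⟩ := h
    rw [zsmul_one] at hp
    exact ⟨p, by linarith⟩
  have hsub : ∀ (y : ℝ) (p : ℤ), ((y - p : ℝ) : UnitAddCircle) = y := by
    intro y p
    simp
  obtain ⟨g, hg⟩ := exists_bijOn_halfOpen hAB hl0 hl1 hB (lo := lo) c
  rw [show (5 : ℝ) = 3 + 2 by norm_num]
  refine exists_isEnumeration_of_subsingleton_diff (by norm_num) (g := g) hg ?_ ?_
  · have key : ∀ n ∈ {n : ℤ | ∃ p : ℤ, n * a + c - p ∈ Ico lo (lo + (A + B * a))} \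
        {n : ℤ | ((n * a + c : ℝ) : UnitAddCircle) ∈ T}, ∃ p : ℤ, n * a + c - p = lo := by
      rintro n ⟨⟨p, hp⟩, hn⟩
      refine ⟨p, ?_⟩
      by_contra hne
      refine hn (hT₁ ⟨_, ⟨lt_of_le_of_ne hp.1 (Ne.symm hne), hp.2⟩, hsub _ p⟩)
    intro n hn n' hn'
    obtain ⟨p, hp⟩ := key n hn
    obtain ⟨p', hp'⟩ := key n' hn'
    exact eq_of_mul_add_sub_eq ha hp hp'
  · have key : ∀ n ∈ {n : ℤ | ((n * a + c : ℝ) : UnitAddCircle) ∈ T} \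
        {n : ℤ | ∃ p : ℤ, n * a + c - p ∈ Ico lo (lo + (A + B * a))},
        ∃ p : ℤ, n * a + c - p = lo + (A + B * a) := by
      rintro n ⟨hn, hn'⟩
      obtain ⟨t, ht, hte⟩ := hT₂ hn
      obtain ⟨p, hp⟩ := hcoe _ _ hte
      refine ⟨p, ?_⟩
      by_contra hne
      refine hn' ⟨p, ?_⟩
      rw [hp] at hne ⊢
      exact ⟨ht.1, lt_of_le_of_ne ht.2 hne⟩
    intro n hn n' hn'
    obtain ⟨p, hp⟩ := key n hn
    obtain ⟨p', hp'⟩ := key n' hn'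
    exact eq_of_mul_add_sub_eq ha hp hp'

/-- An arc lying between an open arc and its closure has positive measure, at most its length. -/
theorem volume_arc {lo ℓ : ℝ} (hℓ : 0 < ℓ) {T : Set UnitAddCircle}
    (hT₁ : (fun t : ℝ => (t : UnitAddCircle)) '' Ioo lo (lo + ℓ) ⊆ T)
    (hT₂ : T ⊆ (fun t : ℝ => (t : UnitAddCircle)) '' Icc lo (lo + ℓ)) :
    0 < MeasureTheory.volume.real T ∧ MeasureTheory.volume.real T ≤ ℓ := by
  constructor
  · refine ENNReal.toReal_pos (ne_of_gt ?_) (MeasureTheory.measure_ne_top _ _)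
    refine lt_of_lt_of_le ?_ (MeasureTheory.measure_mono hT₁)
    refine IsOpen.measure_pos _ (QuotientAddGroup.isOpenMap_coe _ isOpen_Ioo) ?_
    exact (nonempty_Ioo.2 (by linarith)).image _
  · have hball : T ⊆ Metric.closedBall ((lo + ℓ / 2 : ℝ) : UnitAddCircle) (ℓ / 2) := by
      refine hT₂.trans ?_
      rintro _ ⟨t, ht, rfl⟩
      rw [Metric.mem_closedBall, dist_eq_norm]
      have : ‖((t - (lo + ℓ / 2) : ℝ) : UnitAddCircle)‖ ≤ |t - (lo + ℓ / 2)| := by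
        rw [UnitAddCircle.norm_eq]
        simpa using round_le (t - (lo + ℓ / 2)) 0
      refine this.trans ?_
      rw [abs_le]
      constructor <;> linarith [ht.1, ht.2]
    refine ENNReal.toReal_le_of_le_ofReal hℓ.le ((MeasureTheory.measure_mono hball).trans ?_)
    rw [AddCircle.volume_closedBall]
    exact ENNReal.ofReal_le_ofReal ((min_le_right _ _).trans (by linarith))

end CutProject

/-! ### Enumerating integer vectors row by row -/

namespace CutProject

open Set Module

theorem exists_isEnumeration_specialInterval {a : ℝ} (ha : Irrational a) {m : ℕ} (hm : 1 ≤ m)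
    {γ : UnitAddCircle} {T : Set UnitAddCircle}
    (hT₁ : interior (specialInterval (Int.fract a) m γ) ⊆ T)
    (hT₂ : T ⊆ specialInterval (Int.fract a) m γ) :
    ∃ ℓ : ℝ, 0 < ℓ ∧ ℓ ≤ 1 ∧ 0 < MeasureTheory.volume.real T ∧ MeasureTheory.volume.real T ≤ ℓ ∧
      ∀ c : ℝ, ∃ g, IsEnumeration ℓ 5 {n : ℤ | ((n * a + c : ℝ) : UnitAddCircle) ∈ T} g := by
  have hfr : Irrational (Int.fract a) := ha.sub_intCast ⌊a⌋
  obtain ⟨A, B, lo, hAB, hl0, hl1, hB, h₁, h₂⟩ :=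
    specialInterval_arc hfr (fract_pos_of_irrational ha) (Int.fract_lt_one a) hm γ
  -- Passing from {a} to a changes A by a multiple of B, which preserves coprimality.
  have hl : (A : ℝ) + B * Int.fract a = (A + B * -⌊a⌋ : ℤ) + B * a := by
    push_cast
    rw [Int.fract]
    ring
  obtain ⟨hv0, hvl⟩ := volume_arc hl0 (h₁.trans hT₁) (hT₂.trans h₂)
  refine ⟨A + B * Int.fract a, hl0, hl1, hv0, hvl, fun c => ?_⟩
  rw [hl] at hl0 hl1 hB h₁ h₂ ⊢
  exact exists_isEnumeration_hits ha (hAB.add_mul_left_left _) hl0 hl1 hB (h₁.trans hT₁)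
    (hT₂.trans h₂) c

/-- The parameter c is constant along rows in direction i₀, so each row is mapped to itself by its
own bijection. -/
theorem bijOn_update {I : Type*} [DecidableEq I] {i₀ : I} {X : Type*} {c : (I → ℤ) → X}
    (hc : ∀ z n, c (Function.update z i₀ n) = c z) {H : X → Set ℤ} {G : X → ℤ → ℤ}
    (hG : ∀ x, BijOn (G x) (H x) univ) :
    BijOn (fun z => Function.update z i₀ (G (c z) (z i₀))) {z | z i₀ ∈ H (c z)} univ := by
  refine ⟨fun _ _ => mem_univ _, ?_, fun r _ => ?_⟩
  · intro z hz z' hz' h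
    have hcc : c z = c z' := by
      rw [← hc z (G (c z) (z i₀)), ← hc z' (G (c z') (z' i₀))]
      exact congrArg c h
    have h0 : z i₀ = z' i₀ := by
      apply (hG (c z)).injOn hz
      · rw [hcc]
        exact hz'
      · simpa [← hcc] using congrFun h i₀
    ext i
    by_cases hi : i = i₀
    · rw [hi, h0]
    · simpa [hi] using congrFun h i
  · obtain ⟨n, hn, hr⟩ := (hG (c r)).surjOn (mem_univ (r i₀))
    refine ⟨Function.update r i₀ n, ?_, ?_⟩
    · simpa [hc] using hn
    · simp [hc, hr]

/-! ### Coordinates on the hyperplane and the lattice -/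

section Graph

variable {k : ℕ} {V : Submodule ℝ (EuclideanSpace ℝ (Fin k))} {j : Fin k} {a : Fin k → ℝ}

theorem IsGraph.apply_eq (ha : IsGraph V j a) (v : V) :
    v.1 j = ∑ i : {i // i ≠ j}, a i * v.1 i := by
  rw [(ha v).1 v.2]
  exact Finset.sum_subtype _ (by simp) _

/-- The rescaled coordinates other than the `j`-th one on the graph `V`. -/
noncomputable def graphEquiv (ha : IsGraph V j a) (s : {i // i ≠ j} → ℝ) (hs : ∀ i, s i ≠ 0) :
    V ≃ₗ[ℝ] ({i // i ≠ j} → ℝ) :=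
  LinearEquiv.ofBijective
    { toFun := fun v i => s i * v.1 i
      map_add' := fun v w => by
        ext i
        simp [mul_add]
      map_smul' := fun r v => by
        ext i
        simp
        ring } <| by
    refine ⟨fun v w h => ?_, fun u => ?_⟩
    · have hi : ∀ i : {i // i ≠ j}, v.1 i = w.1 i := fun i =>
        mul_left_cancel₀ (hs i) (congrFun h i)
      ext i
      by_cases hij : i = j
      · rw [hij, ha.apply_eq, ha.apply_eq]
        exact Finset.sum_congr rfl fun i _ => by rw [hi]
      · exact hi ⟨i, hij⟩
    · let w : EuclideanSpace ℝ (Fin k) := WithLp.toLp 2 fun i =>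
        if h : i = j then ∑ i : {i // i ≠ j}, a i * (u i / s i) else u ⟨i, h⟩ / s ⟨i, h⟩
      have hw : ∀ i : {i // i ≠ j}, w i = u i / s i := fun i => dif_neg i.2
      have hwV : w ∈ V := by
        rw [ha, Finset.sum_subtype (Finset.univ.erase j) (p := fun i => i ≠ j) (by simp)]
        simp only [hw]
        exact dif_pos rfl
      refine ⟨⟨w, hwV⟩, ?_⟩
      ext i
      show s i * w i = u i
      rw [hw, mul_div_cancel₀ _ (hs i)]

theorem graphEquiv_apply (ha : IsGraph V j a) (s : {i // i ≠ j} → ℝ) (hs : ∀ i, s i ≠ 0) (v : V)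
    (i : {i // i ≠ j}) : graphEquiv ha s hs v i = s i * v.1 i := rfl

theorem IsGraph.exists_norm_le (ha : IsGraph V j a) :
    ∃ K : ℝ, 0 ≤ K ∧ ∀ (v : V) (M : ℝ), 0 ≤ M → (∀ i ≠ j, |v.1 i| ≤ M) → ‖v‖ ≤ K * M := by
  let e := graphEquiv ha (fun _ => 1) (fun _ => one_ne_zero)
  let E := e.symm.toLinearMap.toContinuousLinearMap
  refine ⟨‖E‖, norm_nonneg E, fun v M hM h => ?_⟩
  have hv : E (e v) = v := e.symm_apply_apply v
  have hn : ‖e v‖ ≤ M := by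
    rw [pi_norm_le_iff_of_nonneg hM]
    intro i
    rw [graphEquiv_apply, one_mul]
    exact h i i.2
  calc ‖v‖ = ‖E (e v)‖ := by rw [hv]
    _ ≤ ‖E‖ * ‖e v‖ := E.le_opNorm _
    _ ≤ ‖E‖ * M := by gcongr

/-- The j-th coordinate may be absorbed in t. The offsets are reduced to [0, 1) so that floors
recover the integers. -/
theorem mem_cutAndProject_window {p x : EuclideanSpace ℝ (Fin k)} {T : Set UnitAddCircle} {v : V} :
    v ∈ cutAndProject V (window j p T) x ↔
      (∀ i ≠ j, ∃ n : ℤ, v.1 i = n + Int.fract (p i - x i)) ∧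
        ((v.1 j + x j - p j : ℝ) : UnitAddCircle) ∈ T := by
  have hmem : v ∈ cutAndProject V (window j p T) x ↔ ∃ t : ℝ, (t : UnitAddCircle) ∈ T ∧
      ∀ i, ∃ n : ℤ, -(p i + t * (if i = j then 1 else 0)) + (v.1 i + x i) = n := by
    simp only [cutAndProject, window, proj, mem_ofPred_eq, mem_image, QuotientAddGroup.eq]
    refine exists_congr fun t => and_congr_right fun _ => forall_congr' fun i => ?_
    simp
  rw [hmem]
  constructor
  · rintro ⟨t, ht, h⟩
    refine ⟨fun i hi => ?_, ?_⟩
    · obtain ⟨n, hn⟩ := h i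
      refine ⟨n + ⌊p i - x i⌋, ?_⟩
      rw [if_neg hi] at hn
      push_cast
      rw [add_assoc, Int.floor_add_fract]
      linarith
    · obtain ⟨n, hn⟩ := h j
      rw [if_pos rfl] at hn
      have : v.1 j + x j - p j = t + n := by linarith
      rw [this]
      simpa using ht
  · rintro ⟨h, hT⟩
    refine ⟨_, hT, fun i => ?_⟩
    by_cases hi : i = j
    · refine ⟨0, ?_⟩
      rw [if_pos hi, hi]
      push_cast
      ring
    · obtain ⟨n, hn⟩ := h i hi
      refine ⟨n - ⌊p i - x i⌋, ?_⟩
      have := Int.floor_add_fract (p i - x i)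
      rw [if_neg hi]
      push_cast
      linarith

/-- Here c collects everything in the height v_j + x_j - p_j except the term z_{i₀} a_{i₀}, so
membership along a row is a hitting condition for the rotation by a_{i₀}. -/
theorem bijOn_floor (ha : IsGraph V j a) (i₀ : {i // i ≠ j}) (p x : EuclideanSpace ℝ (Fin k))
    (T : Set UnitAddCircle) :
    ∃ c : ({i // i ≠ j} → ℤ) → ℝ, (∀ z n, c (Function.update z i₀ n) = c z) ∧
      BijOn (fun (v : V) (i : {i // i ≠ j}) => ⌊v.1 i⌋) (cutAndProject V (window j p T) x)
        {z | z i₀ ∈ {n : ℤ | ((n * a i₀ + c z : ℝ) : UnitAddCircle) ∈ T}} := by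
  let β : {i // i ≠ j} → ℝ := fun i => Int.fract (p i - x i)
  let c : ({i // i ≠ j} → ℤ) → ℝ := fun z =>
    (∑ i : {i // i ≠ j}, if i = i₀ then 0 else a i * z i) +
      (∑ i : {i // i ≠ j}, a i * β i + x j - p j)
  have hβ : ∀ (n : ℤ) (i : {i // i ≠ j}), ⌊(n : ℝ) + β i⌋ = n := by
    intro n i
    simp [β]
  have hc : ∀ (z : {i // i ≠ j} → ℤ) (v : V), (∀ i : {i // i ≠ j}, v.1 i = z i + β i) →
      z i₀ * a i₀ + c z = v.1 j + x j - p j := by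
    intro z v hv
    have hsum : ∑ i : {i // i ≠ j}, a i * (z i : ℝ) =
        z i₀ * a i₀ + ∑ i : {i // i ≠ j}, if i = i₀ then 0 else a i * (z i : ℝ) := by
      have : z i₀ * a i₀ = ∑ i : {i // i ≠ j}, if i = i₀ then a i * (z i : ℝ) else 0 := by
        simp [mul_comm]
      rw [this, ← Finset.sum_add_distrib]
      refine Finset.sum_congr rfl fun i _ => ?_
      split_ifs <;> simp
    have hvj : v.1 j = ∑ i : {i // i ≠ j}, a i * (z i : ℝ) + ∑ i : {i // i ≠ j}, a i * β i := by
      rw [ha.apply_eq, ← Finset.sum_add_distrib]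
      refine Finset.sum_congr rfl fun i _ => ?_
      rw [hv, mul_add]
    rw [hvj, hsum]
    ring
  let e := graphEquiv ha (fun _ => 1) (fun _ => one_ne_zero)
  have hev : ∀ (v : V) i, e v i = v.1 i := fun v i => by rw [graphEquiv_apply, one_mul]
  have hY : ∀ v ∈ cutAndProject V (window j p T) x, ∀ i : {i // i ≠ j},
      v.1 i = ⌊v.1 i⌋ + β i := by
    intro v hv i
    obtain ⟨n, hn⟩ := (mem_cutAndProject_window.1 hv).1 i i.2
    have h : v.1 i = n + β i := hn
    rw [h, hβ]
  refine ⟨c, fun z n => ?_, ?_, ?_, ?_⟩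
  · simp only [c]
    congr 1
    refine Finset.sum_congr rfl fun i _ => ?_
    by_cases hi : i = i₀ <;> simp [hi]
  · intro v hv
    have := (mem_cutAndProject_window.1 hv).2
    rwa [← hc _ v (hY v hv)] at this
  · intro v hv w hw h
    apply e.injective
    ext i
    rw [hev, hev, hY v hv, hY w hw, show ⌊v.1 i⌋ = ⌊w.1 i⌋ from congrFun h i]
  · intro z hz
    have hv : ∀ i : {i // i ≠ j}, (e.symm fun i => z i + β i).1 i = z i + β i := by
      intro i
      rw [← hev, e.apply_symm_apply]
    refine ⟨e.symm fun i => z i + β i,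
      mem_cutAndProject_window.2 ⟨fun i hi => ⟨z ⟨i, hi⟩, hv ⟨i, hi⟩⟩, ?_⟩, ?_⟩
    · rw [← hc z _ hv]
      exact hz
    · ext i
      simp only [hv, hβ]

theorem IsGraph.exists_lattice_bijection (ha : IsGraph V j a) {i₀ : Fin k} (hi₀ : i₀ ≠ j) {C : ℝ}
    (hC : ∀ (v : V) (M : ℝ), 0 ≤ M → (∀ i ≠ j, |v.1 i| ≤ M) → ‖v‖ ≤ C * M)
    {T : Set UnitAddCircle} {ℓ D : ℝ} (hD : 0 ≤ D) (hl0 : 0 < ℓ) (hl1 : ℓ ≤ 1)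
    (hg : ∀ c : ℝ, ∃ g, IsEnumeration ℓ D {n : ℤ | ((n * a i₀ + c : ℝ) : UnitAddCircle) ∈ T} g)
    (p x : EuclideanSpace ℝ (Fin k)) :
    ∃ (L : Submodule ℤ V) (_ : DiscreteTopology L), IsZLattice ℝ L ∧
      ∃ f : cutAndProject V (window j p T) x → L, Function.Bijective f ∧
        ∀ y, ‖(f y : V) - (y : V)‖ ≤ C * ((D + 1) / ℓ) := by
  choose G hG using hg
  obtain ⟨c, hc, hfl⟩ := bijOn_floor ha ⟨i₀, hi₀⟩ p x T
  have hbij := (bijOn_update hc fun y => (hG y).1).comp hfl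
  set F : V → {i // i ≠ j} → ℤ := (fun z => Function.update z ⟨i₀, hi₀⟩ (G (c z) (z ⟨i₀, hi₀⟩))) ∘
    fun (v : V) (i : {i // i ≠ j}) => ⌊v.1 i⌋ with hF
  -- Integrality after this rescaling defines the lattice: spacing ℓ⁻¹ in direction i₀, 1 elsewhere.
  let s : {i // i ≠ j} → ℝ := fun i => if i = ⟨i₀, hi₀⟩ then ℓ else 1
  have hs : ∀ i, s i ≠ 0 := by
    intro i
    simp only [s]
    split_ifs
    · exact hl0.ne'
    · exact one_ne_zero
  let e := graphEquiv ha s hs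
  let b := Basis.ofEquivFun e
  have hmem : ∀ v : V, v ∈ Submodule.span ℤ (range b) ↔ ∀ i, ∃ n : ℤ, (n : ℝ) = e v i := by
    intro v
    rw [Basis.mem_span_iff_repr_mem]
    simp [b]
  let f : V → V := fun v => e.symm fun i => F v i
  have hef : ∀ v i, e (f v) i = F v i := fun v i => by rw [e.apply_symm_apply]
  refine ⟨Submodule.span ℤ (range b), inferInstance, inferInstance,
    fun v => ⟨f v, (hmem _).2 fun i => ⟨F v i, (hef v i).symm⟩⟩, ⟨?_, ?_⟩, ?_⟩
  · intro v w h
    have h' : f v = f w := congrArg Subtype.val h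
    refine Subtype.ext (hbij.injOn v.2 w.2 (funext fun i => ?_))
    have := hef v i
    rw [h', hef w i] at this
    exact_mod_cast this.symm
  · rintro ⟨w, hw⟩
    choose r hr using (hmem w).1 hw
    obtain ⟨v, hv, hvr⟩ := hbij.surjOn (mem_univ r)
    refine ⟨⟨v, hv⟩, Subtype.ext (e.injective (funext fun i => ?_))⟩
    rw [← hr, ← hvr]
    exact hef v i
  · rintro ⟨v, hv⟩
    have hpos : 1 ≤ (D + 1) / ℓ := by
      rw [le_div_iff₀ hl0]
      linarith
    refine hC _ _ (zero_le_one.trans hpos) fun i hi => ?_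
    have hcoord : ∀ i : {i // i ≠ j}, s i * (f v).1 i = F v i := fun i => hef v i
    have hfr0 := Int.fract_nonneg (v.1 i)
    have hfr1 := (Int.fract_lt_one (v.1 i)).le
    have hv1 := Int.floor_add_fract (v.1 i)
    show |(f v).1 i - v.1 i| ≤ _
    by_cases hii : i = i₀
    · subst hii
      have h1 := hcoord ⟨i, hi⟩
      simp only [s, hF, if_true, Function.comp, Function.update_self] at h1
      have h2 := abs_le.1 ((hG _).2 _ (hfl.mapsTo hv))
      rw [← h1] at h2
      have habs : |(f v).1 i - v.1 i| * ℓ = |((f v).1 i - v.1 i) * ℓ| := by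
        rw [abs_mul, abs_of_pos hl0]
      rw [le_div_iff₀ hl0, habs, abs_le]
      have hb : 0 ≤ ℓ * Int.fract (v.1 i) := by positivity
      have hb1 : ℓ * Int.fract (v.1 i) ≤ 1 := mul_le_one₀ hl1 hfr0 hfr1
      -- The enumeration contributes at most D, and replacing the coordinate by its floor at most ℓ
      -- ≤ 1.
      have hexp : ((f v).1 i - v.1 i) * ℓ =
          (ℓ * (f v).1 i - ℓ * ⌊v.1 i⌋) - ℓ * Int.fract (v.1 i) := by
        rw [Int.fract]
        ring
      rw [hexp]
      constructor <;> linarith [h2.1, h2.2]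
    · have h1 := hcoord ⟨i, hi⟩
      simp only [s, hF, Subtype.mk.injEq, hii, if_false, one_mul, Function.comp, ne_eq,
        not_false_eq_true, Function.update_of_ne] at h1
      rw [h1]
      refine le_trans ?_ hpos
      rw [abs_le]
      constructor <;> linarith

end Graph

end CutProject

theorem theorem1p1 (k : ℕ) (V : Submodule ℝ (EuclideanSpace ℝ (Fin k)))
    (hV : Module.finrank ℝ V + 1 = k) :
    ∃ K : ℝ, ∀ (j : Fin k) (p x : EuclideanSpace ℝ (Fin k)) (T : Set UnitAddCircle),
      CutProject.IsSpecialIntervalFor V j T →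
        ∃ (L : Submodule ℤ V) (_ : DiscreteTopology L), IsZLattice ℝ L ∧
          ∃ f : CutProject.cutAndProject V (CutProject.window j p T) x → L,
            Function.Bijective f ∧
              ∀ y, ‖(f y : V) - (y : V)‖ ≤ K * (MeasureTheory.volume.real T)⁻¹ := by
  -- The norm constant is fixed for each j before any window is chosen; directions e_j in V get the
  -- default 0, and summing over j gives one constant.
  have hC : ∀ j : Fin k, ∃ C : ℝ, 0 ≤ C ∧ ((∃ a, CutProject.IsGraph V j a) →
      ∀ (v : V) (M : ℝ), 0 ≤ M → (∀ i ≠ j, |v.1 i| ≤ M) → ‖v‖ ≤ C * M) := by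
    intro j
    by_cases h : ∃ a, CutProject.IsGraph V j a
    · obtain ⟨a, ha⟩ := h
      obtain ⟨C, hC0, hC⟩ := ha.exists_norm_le
      exact ⟨C, hC0, fun _ => hC⟩
    · exact ⟨0, le_rfl, fun h' => absurd h' h⟩
  choose C hC0 hC using hC
  refine ⟨6 * ∑ j, C j, ?_⟩
  rintro j p x T ⟨a, ha, i, hij, hirr, m, hm, γ, hT₁, hT₂⟩
  obtain ⟨ℓ, hl0, hl1, hv0, hvl, hg⟩ :=
    CutProject.exists_isEnumeration_specialInterval hirr hm hT₁ hT₂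
  obtain ⟨L, hL, hZ, f, hf, hb⟩ :=
    ha.exists_lattice_bijection hij (hC j ⟨a, ha⟩) (by norm_num) hl0 hl1 hg p x
  refine ⟨L, hL, hZ, f, hf, fun y => (hb y).trans ?_⟩
  have hinv : ℓ⁻¹ ≤ (MeasureTheory.volume.real T)⁻¹ := inv_anti₀ hv0 hvl
  have hCj : C j ≤ ∑ j, C j := Finset.single_le_sum (fun i _ => hC0 i) (Finset.mem_univ j)
  calc C j * ((5 + 1) / ℓ) = 6 * C j * ℓ⁻¹ := by ring
    _ ≤ 6 * (∑ j, C j) * (MeasureTheory.volume.real T)⁻¹ := by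
      have := (hC0 j).trans hCj
      gcongr
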